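/- Let $k$ be a positive integer. An EVEN colored composition of $k$ is a finite sequence of positive integers (parts) $p_1, p_2, \dots, p_s$ with $p_1+\cdots+p_s=k$, in which every part $p_i$ in an even position $i$ is assigned one of the $p_i$ colors $1,2,\dots,p_i$, while the parts in odd positions are not colored. A permutation of $[k]=\{1,\dots,k\}$ is called separable if it avoids the patterns $2413$ and $3142$. Theorem. For every positive integer $k$, the EVEN colored compositions of $k$ are equinumerous with the $321$-avoiding separable permutations of $[k]$; that is, there is a bijection between the set of EVEN colored compositions of $k$ and the set of permutations of $[k]$ that avoid $321$, $2413$ and $3142$. -/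

import Mathlib

/-- A `(m, r)`-`n`-colored composition of `n`: a composition of `n` together with, for every part
in a position `≡ r (mod m)` (positions are counted from `1`), a color between `1` and the size of
that part.  The parts in the other positions carry no color. -/
abbrev PositionalColoredComposition (m r n : ℕ) : Type :=
  Σ c : Composition n,
    ∀ i : {i : Fin c.length // (i : ℕ) + 1 ≡ r [MOD m]}, Finset.Icc 1 (c.blocksFun i.1)

/-- EVEN colored compositions: exactly the parts in even positions are colored. -/
abbrev EvenColoredComposition (n : ℕ) : Type :=
  PositionalColoredComposition 2 0 n

/-- The permutation `σ` contains the pattern `p`, given in one-line notation: some subsequence of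
`σ(1), …, σ(n)` is in the same relative order as `p`. -/
def ContainsPattern {n m : ℕ} (σ : Equiv.Perm (Fin n)) (p : Fin m → ℕ) : Prop :=
  ∃ f : Fin m → Fin n, StrictMono f ∧ ∀ i j : Fin m, σ (f i) < σ (f j) ↔ p i < p j

/-- The permutation `σ` avoids the pattern `p`. -/
def AvoidsPattern {n m : ℕ} (σ : Equiv.Perm (Fin n)) (p : Fin m → ℕ) : Prop :=
  ¬ ContainsPattern σ p

/-- Separable permutations: those that avoid both `2413` and `3142`. -/
def IsSeparablePerm {n : ℕ} (σ : Equiv.Perm (Fin n)) : Prop :=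
  AvoidsPattern σ ![2, 4, 1, 3] ∧ AvoidsPattern σ ![3, 1, 4, 2]

/-!
Both families are counted by the sequence `X` with `X 0 = 1` and
`X (n + 1) = X n + ∑ p * X r`, the sum running over all `(p, r)` with `p + r = n`.

*Compositions.*  Take an EVEN colored composition of `n + 1`.  If its first part exceeds `1`, lowering
that part by `1` gives an EVEN colored composition of `n`.  If its first part is `1`, it is followed
by a second part `p` in one of `p` colors and by an EVEN colored composition of `n - p` (or, for
`n = 0`, by nothing).  In terms of cardinalities this is `card_evenColored_succ`.

*Permutations.*  If `σ 0 = 0`, then `σ` is the direct sum of the one-point permutation and a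
permutation in the class.  Otherwise put `b = σ 0` and `a = σ⁻¹ 0`, both positive.  Avoidance of
`321` makes `σ` increasing on the positions before `a`, and avoidance of `2413` leaves no gaps among
their values, so these are `b, b + 1, …, b + a - 1`; applied to `σ⁻¹` the same argument shows that
the values `0, …, b - 1` stand, in this order, at the positions `a, …, a + b - 1`
(`HasFirstBlock.of_apply_zero`).  Hence `σ` is the direct sum of this block and a
permutation in the class.
Conversely all such direct sums lie in the class, because the three patterns are indecomposable
(`containsPattern_directSum`).  There are `p` blocks of size `p + 1` with `a, b ≥ 1`, which gives the
recurrence (`card_sepAvoiding_succ`).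
-/

/-! ### Counting colored compositions -/

/-- The number of ways to color the parts listed in `l` when exactly the parts in positions
`≡ r (mod 2)` (counted from `1`) receive a color, a part `p` having `p` colors to choose from. -/
def coloringWeight (r : ℕ) (l : List ℕ) : ℕ :=
  ∏ i : Fin l.length, if (i : ℕ) + 1 ≡ r [MOD 2] then l.get i else 1

theorem coloringWeight_nil (r : ℕ) : coloringWeight r [] = 1 := by
  simp [coloringWeight]

theorem coloringWeight_zero_cons (p : ℕ) (l : List ℕ) :
    coloringWeight 0 (p :: l) = coloringWeight 1 l := by
  unfold coloringWeight
  simp only [List.length_cons]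
  rw [Fin.prod_univ_succ]
  simp only [List.get_cons_zero, List.get_cons_succ', Fin.val_succ]
  rw [if_neg (by simp [Nat.ModEq]), one_mul]
  refine Finset.prod_congr rfl fun i _ => if_congr ?_ rfl rfl
  simp only [Nat.ModEq]
  omega

theorem coloringWeight_one_cons (p : ℕ) (l : List ℕ) :
    coloringWeight 1 (p :: l) = p * coloringWeight 0 l := by
  unfold coloringWeight
  simp only [List.length_cons]
  rw [Fin.prod_univ_succ]
  simp only [List.get_cons_zero, List.get_cons_succ', Fin.val_succ]
  rw [if_pos (by simp [Nat.ModEq])]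
  congr 1
  refine Finset.prod_congr rfl fun i _ => if_congr ?_ rfl rfl
  simp only [Nat.ModEq]
  omega

theorem card_positionalColoredComposition (r n : ℕ) :
    Nat.card (PositionalColoredComposition 2 r n) =
      ∑ c : Composition n, coloringWeight r c.blocks := by
  rw [Nat.card_eq_fintype_card, Fintype.card_sigma]
  refine Finset.sum_congr rfl fun c _ => ?_
  rw [Fintype.card_pi, coloringWeight, Finset.prod_ite, Finset.prod_const_one, mul_one]
  simp only [Fintype.card_coe, Nat.card_Icc, Nat.add_sub_cancel]
  symm
  exact Finset.prod_subtype _ (by simp) _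

/-- The lists of parts of the compositions of `n`. -/
def compositionLists (n : ℕ) : Finset (List ℕ) :=
  Finset.univ.image (Composition.blocks : Composition n → List ℕ)

theorem mem_compositionLists {n : ℕ} {l : List ℕ} :
    l ∈ compositionLists n ↔ (∀ p ∈ l, 0 < p) ∧ l.sum = n := by
  simp only [compositionLists, Finset.mem_image, Finset.mem_univ, true_and]
  constructor
  · rintro ⟨c, rfl⟩
    exact ⟨fun _ => c.blocks_pos, c.blocks_sum⟩
  · rintro ⟨h, h'⟩
    exact ⟨⟨l, fun {i} => h i, h'⟩, rfl⟩

theorem sum_composition_eq (n : ℕ) (f : List ℕ → ℕ) :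
    ∑ c : Composition n, f c.blocks = ∑ l ∈ compositionLists n, f l := by
  rw [compositionLists, Finset.sum_image]
  intro c _ d _ h
  exact Composition.ext h

/-- Summation over the compositions of `n + 1`, arranged by the first part. -/
theorem sum_composition_succ (n : ℕ) (f : List ℕ → ℕ) :
    ∑ c : Composition (n + 1), f c.blocks =
      ∑ x ∈ Finset.HasAntidiagonal.antidiagonal n,
        ∑ c : Composition x.2, f ((x.1 + 1) :: c.blocks) := by
  rw [sum_composition_eq]
  rw [Finset.sum_congr rfl fun (x : ℕ × ℕ) _ => sum_composition_eq x.2 fun l => f ((x.1 + 1) :: l),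
    Finset.sum_sigma']
  refine Finset.sum_bij' (fun l _ => ⟨(l.headI - 1, l.tail.sum), l.tail⟩)
    (fun s _ => (s.1.1 + 1) :: s.2) ?_ ?_ ?_ ?_ ?_
  · rintro (_ | ⟨p, l⟩) h
    · simp [mem_compositionLists] at h
    · simp only [mem_compositionLists, List.mem_cons, List.sum_cons, forall_eq_or_imp] at h
      simp only [Finset.mem_sigma, Finset.HasAntidiagonal.mem_antidiagonal, mem_compositionLists,
        List.headI_cons, List.tail_cons]
      exact ⟨by omega, h.1.2, trivial⟩
  · rintro ⟨⟨p, r⟩, l⟩ h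
    simp only [Finset.mem_sigma, Finset.HasAntidiagonal.mem_antidiagonal, mem_compositionLists] at h
    simp only [mem_compositionLists, List.mem_cons, List.sum_cons, forall_eq_or_imp]
    exact ⟨⟨by omega, h.2.1⟩, by omega⟩
  · rintro (_ | ⟨p, l⟩) h
    · simp [mem_compositionLists] at h
    · simp only [mem_compositionLists, List.mem_cons, List.sum_cons, forall_eq_or_imp] at h
      simp only [List.headI_cons, List.tail_cons, List.cons.injEq, and_true]
      omega
  · rintro ⟨⟨p, r⟩, l⟩ h
    simp only [Finset.mem_sigma, Finset.HasAntidiagonal.mem_antidiagonal, mem_compositionLists] at h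
    obtain ⟨-, -, rfl⟩ := h
    simp
  · rintro (_ | ⟨p, l⟩) h
    · simp [mem_compositionLists] at h
    · simp only [mem_compositionLists, List.mem_cons, List.sum_cons, forall_eq_or_imp] at h
      simp only [List.headI_cons, List.tail_cons]
      rw [Nat.sub_add_cancel h.1.1]

theorem card_positionalColoredComposition_zero (r : ℕ) :
    Nat.card (PositionalColoredComposition 2 r 0) = 1 := by
  rw [card_positionalColoredComposition, sum_composition_eq]
  have : compositionLists 0 = {[]} := by
    ext l
    rw [mem_compositionLists, Finset.mem_singleton]
    constructor
    · rintro ⟨h, h'⟩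
      cases l with
      | nil => rfl
      | cons p l =>
        have := h p (by simp)
        simp at h'
        omega
    · rintro rfl
      simp
  rw [this, Finset.sum_singleton, coloringWeight_nil]

theorem card_evenColored_eq_sum (n : ℕ) :
    Nat.card (EvenColoredComposition (n + 1)) =
      ∑ x ∈ Finset.HasAntidiagonal.antidiagonal n,
        Nat.card (PositionalColoredComposition 2 1 x.2) := by
  simp only [card_positionalColoredComposition]
  rw [sum_composition_succ]
  simp only [coloringWeight_zero_cons]

theorem card_oddColored_eq_sum (n : ℕ) :
    Nat.card (PositionalColoredComposition 2 1 (n + 1)) =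
      ∑ x ∈ Finset.HasAntidiagonal.antidiagonal n,
        (x.1 + 1) * Nat.card (EvenColoredComposition x.2) := by
  simp only [card_positionalColoredComposition]
  rw [sum_composition_succ]
  simp only [coloringWeight_one_cons, Finset.mul_sum]

theorem card_evenColored_succ (n : ℕ) :
    Nat.card (EvenColoredComposition (n + 1)) = Nat.card (EvenColoredComposition n) +
      ∑ x ∈ Finset.HasAntidiagonal.antidiagonal n,
        x.1 * Nat.card (EvenColoredComposition x.2) := by
  cases n with
  | zero =>
    rw [card_evenColored_eq_sum]
    simp only [Finset.Nat.antidiagonal_zero, Finset.sum_singleton,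
      card_positionalColoredComposition_zero, zero_mul, add_zero]
  | succ n =>
    rw [card_evenColored_eq_sum (n + 1), Finset.Nat.sum_antidiagonal_succ,
      Finset.Nat.sum_antidiagonal_succ, zero_mul, zero_add, card_oddColored_eq_sum,
      ← card_evenColored_eq_sum, add_comm]

/-! ### Direct sums and indecomposable patterns -/

/-- The direct sum `π ⊕ τ`: `π` on the first `m` points, a shifted copy of `τ` on the last `r`. -/
def directSum {m r : ℕ} (π : Equiv.Perm (Fin m)) (τ : Equiv.Perm (Fin r)) :
    Equiv.Perm (Fin (m + r)) :=
  finSumFinEquiv.permCongr (Equiv.Perm.sumCongr π τ)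

@[simp]
theorem directSum_castAdd {m r : ℕ} (π : Equiv.Perm (Fin m)) (τ : Equiv.Perm (Fin r)) (i : Fin m) :
    directSum π τ (Fin.castAdd r i) = Fin.castAdd r (π i) := by
  simp [directSum, Equiv.permCongr_apply]

@[simp]
theorem directSum_natAdd {m r : ℕ} (π : Equiv.Perm (Fin m)) (τ : Equiv.Perm (Fin r)) (i : Fin r) :
    directSum π τ (Fin.natAdd m i) = Fin.natAdd m (τ i) := by
  simp [directSum, Equiv.permCongr_apply]

theorem directSum_right_injective {m r : ℕ} (π : Equiv.Perm (Fin m)) :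
    Function.Injective (directSum π : Equiv.Perm (Fin r) → _) := by
  intro τ τ' h
  refine Equiv.ext fun i => ?_
  have := congrArg (fun σ => σ (Fin.natAdd m i)) h
  simpa using this

theorem exists_directSum_eq {m r : ℕ} (π : Equiv.Perm (Fin m)) (σ : Equiv.Perm (Fin (m + r)))
    (h : ∀ i, σ (Fin.castAdd r i) = Fin.castAdd r (π i)) : ∃ τ, directSum π τ = σ := by
  obtain ⟨⟨π', τ⟩, hτ⟩ := Equiv.Perm.mem_sumCongrHom_range_of_perm_mapsTo_inl
    (σ := finSumFinEquiv.symm.permCongr σ) (by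
      rintro _ ⟨i, rfl⟩
      exact ⟨π i, by simp [Equiv.permCongr_apply, h]⟩)
  have hσ : directSum π' τ = σ := by
    rw [Equiv.Perm.sumCongrHom_apply] at hτ
    rw [directSum, hτ]
    ext x
    simp [Equiv.permCongr_apply]
  have hπ : π' = π := by
    ext i
    have := h i
    rw [← hσ, directSum_castAdd] at this
    simpa using congrArg Fin.val this
  exact ⟨τ, hπ ▸ hσ⟩

theorem directSum_apply_lt_iff {m r : ℕ} (π : Equiv.Perm (Fin m)) (τ : Equiv.Perm (Fin r))
    (x : Fin (m + r)) : (directSum π τ x : ℕ) < m ↔ (x : ℕ) < m := by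
  induction x using Fin.addCases <;> simp

/-- A pattern is indecomposable if no proper nonempty initial segment of it has all its entries
at most the later ones. -/
def IsIndecomposablePattern {l : ℕ} (p : Fin l → ℕ) : Prop :=
  ∀ c : Fin l, 0 < (c : ℕ) → ∃ i j, i < c ∧ c ≤ j ∧ p j < p i

theorem containsPattern_directSum {m r l : ℕ} (π : Equiv.Perm (Fin m)) (τ : Equiv.Perm (Fin r))
    {p : Fin l → ℕ} (hp : IsIndecomposablePattern p) :
    ContainsPattern (directSum π τ) p ↔ ContainsPattern π p ∨ ContainsPattern τ p := by
  constructor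
  · rintro ⟨f, hf, hfp⟩
    by_cases hleft : ∀ i, (f i : ℕ) < m
    · refine Or.inl ⟨fun i => ⟨f i, hleft i⟩, fun i j hij => hf hij, fun i j => ?_⟩
      have key : ∀ i, f i = Fin.castAdd r ⟨f i, hleft i⟩ := fun i => rfl
      rw [← hfp, key i, key j, directSum_castAdd, directSum_castAdd]
      rfl
    · -- the first index at which the occurrence leaves the left summand
      obtain ⟨c, hc, hmin⟩ := WellFounded.has_min wellFounded_lt {i | ¬ (f i : ℕ) < m}
        (by simpa [Set.Nonempty] using hleft)
      have hbefore : ∀ i, i < c → (f i : ℕ) < m := fun i hi => by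
        by_contra h
        exact hmin i h hi
      have hafter : ∀ i, c ≤ i → m ≤ (f i : ℕ) := fun i hi =>
        (not_lt.mp hc).trans (hf.monotone hi)
      have hc0 : (c : ℕ) = 0 := by
        by_contra h0
        obtain ⟨i, j, hi, hj, hij⟩ := hp c (Nat.pos_of_ne_zero h0)
        have h1 := (hfp j i).2 hij
        have h2 := (directSum_apply_lt_iff π τ _).2 (hbefore i hi)
        have h3 := (directSum_apply_lt_iff π τ (f j)).1 (lt_trans h1 h2)
        exact absurd h3 (not_lt.mpr (hafter j hj))
      have hright : ∀ i, m ≤ (f i : ℕ) := fun i => hafter i (by simp [Fin.le_def, hc0])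
      have hlt : ∀ i, (f i : ℕ) - m < r := fun i => by have := hright i; omega
      have key : ∀ i, f i = Fin.natAdd m ⟨(f i : ℕ) - m, hlt i⟩ := fun i => by
        ext
        have := hright i
        simp only [Fin.val_natAdd]
        omega
      refine Or.inr ⟨fun i => ⟨(f i : ℕ) - m, hlt i⟩, fun i j hij => ?_, fun i j => ?_⟩
      · have h1 : (f i : ℕ) < f j := hf hij
        have := hright i
        simp only [Fin.mk_lt_mk]
        omega
      · rw [← hfp, key i, key j, directSum_natAdd, directSum_natAdd]
        simp only [Fin.natAdd_lt_natAdd_iff]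
  · rintro (⟨f, hf, hfp⟩ | ⟨f, hf, hfp⟩)
    · refine ⟨fun i => Fin.castAdd r (f i), fun i j hij => hf hij, fun i j => ?_⟩
      rw [← hfp, directSum_castAdd, directSum_castAdd]
      rfl
    · refine ⟨fun i => Fin.natAdd m (f i), fun i j hij => ?_, fun i j => ?_⟩
      · simpa using hf hij
      · rw [← hfp, directSum_natAdd, directSum_natAdd]
        simp

/-- The separable permutations avoiding `321`. -/
def IsSepAvoiding {n : ℕ} (σ : Equiv.Perm (Fin n)) : Prop :=
  AvoidsPattern σ ![3, 2, 1] ∧ IsSeparablePerm σ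

theorem isSepAvoiding_directSum {m r : ℕ} (π : Equiv.Perm (Fin m)) (τ : Equiv.Perm (Fin r)) :
    IsSepAvoiding (directSum π τ) ↔ IsSepAvoiding π ∧ IsSepAvoiding τ := by
  have h1 : IsIndecomposablePattern ![3, 2, 1] := by unfold IsIndecomposablePattern; decide
  have h2 : IsIndecomposablePattern ![2, 4, 1, 3] := by unfold IsIndecomposablePattern; decide
  have h3 : IsIndecomposablePattern ![3, 1, 4, 2] := by unfold IsIndecomposablePattern; decide
  simp only [IsSepAvoiding, IsSeparablePerm, AvoidsPattern, containsPattern_directSum π τ h1,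
    containsPattern_directSum π τ h2, containsPattern_directSum π τ h3]
  tauto

/-! ### Occurrences of the three patterns -/

theorem containsPattern_321_iff {n : ℕ} (σ : Equiv.Perm (Fin n)) :
    ContainsPattern σ ![3, 2, 1] ↔ ∃ i j k, i < j ∧ j < k ∧ σ k < σ j ∧ σ j < σ i := by
  constructor
  · rintro ⟨f, hf, h⟩
    exact ⟨f 0, f 1, f 2, hf (by decide), hf (by decide), (h 2 1).2 (by decide),
      (h 1 0).2 (by decide)⟩
  · rintro ⟨i, j, k, hij, hjk, h1, h2⟩
    refine ⟨![i, j, k], ?_, ?_⟩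
    · rw [Fin.strictMono_iff_lt_succ]
      intro x
      fin_cases x <;> assumption
    · intro x y
      rw [Fin.lt_def] at *
      fin_cases x <;> fin_cases y <;> simp [-Fin.val_fin_lt, -Fin.val_fin_le] <;> omega

theorem containsPattern_2413_iff {n : ℕ} (σ : Equiv.Perm (Fin n)) :
    ContainsPattern σ ![2, 4, 1, 3] ↔
      ∃ i j k l, i < j ∧ j < k ∧ k < l ∧ σ k < σ i ∧ σ i < σ l ∧ σ l < σ j := by
  constructor
  · rintro ⟨f, hf, h⟩
    exact ⟨f 0, f 1, f 2, f 3, hf (by decide), hf (by decide), hf (by decide),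
      (h 2 0).2 (by decide), (h 0 3).2 (by decide), (h 3 1).2 (by decide)⟩
  · rintro ⟨i, j, k, l, hij, hjk, hkl, h1, h2, h3⟩
    refine ⟨![i, j, k, l], ?_, ?_⟩
    · rw [Fin.strictMono_iff_lt_succ]
      intro x
      fin_cases x <;> assumption
    · intro x y
      rw [Fin.lt_def] at *
      fin_cases x <;> fin_cases y <;> simp [-Fin.val_fin_lt, -Fin.val_fin_le] <;> omega

theorem containsPattern_3142_iff {n : ℕ} (σ : Equiv.Perm (Fin n)) :
    ContainsPattern σ ![3, 1, 4, 2] ↔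
      ∃ i j k l, i < j ∧ j < k ∧ k < l ∧ σ j < σ l ∧ σ l < σ i ∧ σ i < σ k := by
  constructor
  · rintro ⟨f, hf, h⟩
    exact ⟨f 0, f 1, f 2, f 3, hf (by decide), hf (by decide), hf (by decide),
      (h 1 3).2 (by decide), (h 3 0).2 (by decide), (h 0 2).2 (by decide)⟩
  · rintro ⟨i, j, k, l, hij, hjk, hkl, h1, h2, h3⟩
    refine ⟨![i, j, k, l], ?_, ?_⟩
    · rw [Fin.strictMono_iff_lt_succ]
      intro x
      fin_cases x <;> assumption
    · intro x y
      rw [Fin.lt_def] at *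
      fin_cases x <;> fin_cases y <;> simp [-Fin.val_fin_lt, -Fin.val_fin_le] <;> omega

/-- The class is closed under inversion, which fixes `321` and exchanges `2413` and `3142`. -/
theorem IsSepAvoiding.symm {n : ℕ} {σ : Equiv.Perm (Fin n)} (h : IsSepAvoiding σ) :
    IsSepAvoiding σ.symm := by
  obtain ⟨h1, h2, h3⟩ := h
  rw [AvoidsPattern, containsPattern_321_iff] at h1
  rw [AvoidsPattern, containsPattern_2413_iff] at h2
  rw [AvoidsPattern, containsPattern_3142_iff] at h3
  refine ⟨?_, ?_, ?_⟩
  · rw [AvoidsPattern, containsPattern_321_iff]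
    rintro ⟨i, j, k, h⟩
    exact h1 ⟨σ.symm k, σ.symm j, σ.symm i, by simpa using ⟨h.2.2.1, h.2.2.2, h.1, h.2.1⟩⟩
  · rw [AvoidsPattern, containsPattern_2413_iff]
    rintro ⟨i, j, k, l, h⟩
    exact h3 ⟨σ.symm k, σ.symm i, σ.symm l, σ.symm j, by
      simpa using ⟨h.2.2.2.1, h.2.2.2.2.1, h.2.2.2.2.2, h.1, h.2.1, h.2.2.1⟩⟩
  · rw [AvoidsPattern, containsPattern_3142_iff]
    rintro ⟨i, j, k, l, h⟩
    exact h2 ⟨σ.symm j, σ.symm l, σ.symm i, σ.symm k, by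
      simpa using ⟨h.2.2.2.1, h.2.2.2.2.1, h.2.2.2.2.2, h.1, h.2.1, h.2.2.1⟩⟩

/-! ### The first block of a permutation -/

/-- The permutation `σ` starts with the block `(a, b)`: the first `a` positions carry the values
`b, …, b + a - 1`, the next `b` positions the values `0, …, b - 1`, both in increasing order.
For `a = 1`, `b = 0` this says that `0` is a fixed point.
The inequality `a + b ≤ n` is not part of the definition. -/
def HasFirstBlock {n : ℕ} (a b : ℕ) (σ : Equiv.Perm (Fin n)) : Prop :=
  ∀ i : Fin n, ((i : ℕ) < a → (σ i : ℕ) = b + i) ∧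
    (a ≤ (i : ℕ) → (i : ℕ) < a + b → (σ i : ℕ) + a = i)

/-- The block `(a, b)` as a permutation of its own: a rotation by `b`. -/
def blockPerm (a b : ℕ) : Equiv.Perm (Fin (a + b)) :=
  finAddFlip.trans (finCongr (add_comm b a))

theorem blockPerm_hasFirstBlock (a b : ℕ) : HasFirstBlock a b (blockPerm a b) := by
  intro i
  induction i using Fin.addCases with
  | left i =>
    have := i.isLt
    simp only [blockPerm, Equiv.trans_apply, finAddFlip_apply_castAdd, finCongr_apply,
      Fin.val_cast, Fin.val_natAdd, Fin.val_castAdd]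
    exact ⟨fun _ => trivial, fun _ _ => by omega⟩
  | right i =>
    have := i.isLt
    simp only [blockPerm, Equiv.trans_apply, finAddFlip_apply_natAdd, finCongr_apply,
      Fin.val_cast, Fin.val_natAdd, Fin.val_castAdd]
    omega

theorem isSepAvoiding_blockPerm (a b : ℕ) : IsSepAvoiding (blockPerm a b) := by
  have h := blockPerm_hasFirstBlock a b
  have key : ∀ i : Fin (a + b), ((i : ℕ) < a ∧ (blockPerm a b i : ℕ) = b + i) ∨
      (a ≤ (i : ℕ) ∧ (blockPerm a b i : ℕ) + a = i) := fun i => by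
    have := i.isLt
    rcases lt_or_ge (i : ℕ) a with hi | hi
    · exact Or.inl ⟨hi, (h i).1 hi⟩
    · exact Or.inr ⟨hi, (h i).2 hi this⟩
  refine ⟨?_, ?_, ?_⟩
  · rw [AvoidsPattern, containsPattern_321_iff]
    rintro ⟨i, j, k, h⟩
    have hi := key i
    have hj := key j
    have hk := key k
    simp only [Fin.lt_def] at h
    omega
  · rw [AvoidsPattern, containsPattern_2413_iff]
    rintro ⟨i, j, k, l, h⟩
    have hi := key i
    have hj := key j
    have hk := key k
    have hl := key l
    simp only [Fin.lt_def] at h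
    omega
  · rw [AvoidsPattern, containsPattern_3142_iff]
    rintro ⟨i, j, k, l, h⟩
    have hi := key i
    have hj := key j
    have hk := key k
    have hl := key l
    simp only [Fin.lt_def] at h
    omega

/-- Half of the block structure: the positions before the one of the value `0` carry consecutive
values. -/
theorem IsSepAvoiding.apply_eq_of_lt {n : ℕ} {σ : Equiv.Perm (Fin (n + 1))} (h : IsSepAvoiding σ)
    (i : ℕ) (hi : i < n + 1) (hia : i < (σ.symm 0 : ℕ)) : (σ ⟨i, hi⟩ : ℕ) = σ 0 + i := by
  obtain ⟨h1, h2, -⟩ := h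
  rw [AvoidsPattern, containsPattern_321_iff] at h1
  rw [AvoidsPattern, containsPattern_2413_iff] at h2
  have ne_zero : ∀ x, x < σ.symm 0 → 0 < σ x := fun x hx => by
    refine Fin.pos_iff_ne_zero.2 fun h0 => ?_
    rw [← h0, Equiv.symm_apply_apply] at hx
    exact lt_irrefl _ hx
  have mono : ∀ x y, x < y → y < σ.symm 0 → σ x < σ y := fun x y hxy hy => by
    by_contra hlt
    refine h1 ⟨x, y, σ.symm 0, hxy, hy, by simpa using ne_zero y hy, ?_⟩
    exact lt_of_le_of_ne (not_lt.1 hlt) fun e => hxy.ne' (σ.injective e)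
  induction i with
  | zero => rfl
  | succ i ih =>
    have ih' := ih (by omega) (by omega)
    have hstep := mono ⟨i, by omega⟩ ⟨i + 1, hi⟩ (by simp [Fin.lt_def]) hia
    rw [Fin.lt_def, ih'] at hstep
    by_contra hne
    -- the skipped value `σ 0 + (i + 1)` stands to the right of `0`, completing a `2413`
    have hv : (σ 0 : ℕ) + (i + 1) < n + 1 := by
      have := (σ ⟨i + 1, hi⟩).isLt
      omega
    obtain ⟨x, hx⟩ := σ.surjective ⟨(σ 0 : ℕ) + (i + 1), hv⟩
    have hxv : (σ x : ℕ) = σ 0 + (i + 1) := by rw [hx]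
    rcases lt_trichotomy x (σ.symm 0) with hxa | hxa | hxa
    · rcases lt_trichotomy x ⟨i + 1, hi⟩ with hlt | heq | hgt
      · rcases (Nat.lt_succ_iff.1 (Fin.lt_def.1 hlt)).lt_or_eq with hxi | hxi
        · have := mono x ⟨i, by omega⟩ hxi (Fin.lt_def.2 (by simp; omega))
          rw [Fin.lt_def] at this
          omega
        · have : x = ⟨i, by omega⟩ := Fin.ext hxi
          rw [this] at hxv
          omega
      · rw [heq] at hxv
        omega
      · have := mono _ _ hgt hxa
        rw [Fin.lt_def] at this
        omega
    · rw [hxa, Equiv.apply_symm_apply] at hxv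
      simp at hxv
    · refine h2 ⟨0, ⟨i + 1, hi⟩, σ.symm 0, x, by simp [Fin.lt_def], hia, hxa, ?_, ?_, ?_⟩
      · rw [Equiv.apply_symm_apply]
        exact ne_zero 0 (Fin.lt_def.2 (by rw [Fin.val_zero]; omega))
      · rw [Fin.lt_def]
        omega
      · rw [Fin.lt_def]
        omega

theorem HasFirstBlock.of_apply_zero {n : ℕ} {σ : Equiv.Perm (Fin (n + 1))} (h : IsSepAvoiding σ) :
    HasFirstBlock (σ.symm 0 : ℕ) (σ 0 : ℕ) σ := by
  refine fun i => ⟨fun hi => h.apply_eq_of_lt i i.isLt hi, fun hi hi' => ?_⟩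
  obtain ⟨j, hj⟩ := Nat.exists_eq_add_of_le hi
  have hjb : j < (σ 0 : ℕ) := by omega
  have hjn : j < n + 1 := by have := (σ 0).isLt; omega
  have := h.symm.apply_eq_of_lt j hjn (by simpa using hjb)
  have hij : σ.symm ⟨j, hjn⟩ = i := Fin.ext (by omega)
  rw [← hij, Equiv.apply_symm_apply, hij]
  simp only
  omega

theorem IsSepAvoiding.symm_zero_add_apply_zero_le {n : ℕ} {σ : Equiv.Perm (Fin (n + 1))}
    (h : IsSepAvoiding σ) : (σ.symm 0 : ℕ) + (σ 0 : ℕ) ≤ n + 1 := by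
  have hb := (σ 0).isLt
  rcases Nat.eq_zero_or_pos (σ 0 : ℕ) with h0 | h0
  · have := (σ.symm 0).isLt
    omega
  · have := h.symm.apply_eq_of_lt ((σ 0 : ℕ) - 1) (by omega) (by rw [Equiv.symm_symm]; omega)
    have := (σ.symm ⟨(σ 0 : ℕ) - 1, by omega⟩).isLt
    omega

/-! ### Counting the permutations -/

/-- A permutation in the class with a given first block is the direct sum of that block and an
arbitrary permutation in the class. -/
theorem card_hasFirstBlock {a b r n : ℕ} (hn : n = a + b + r) :
    Nat.card {σ : Equiv.Perm (Fin n) // IsSepAvoiding σ ∧ HasFirstBlock a b σ} =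
      Nat.card {τ : Equiv.Perm (Fin r) // IsSepAvoiding τ} := by
  subst hn
  have key : ∀ σ : Equiv.Perm (Fin (a + b + r)), HasFirstBlock a b σ ↔
      ∀ i, σ (Fin.castAdd r i) = Fin.castAdd r (blockPerm a b i) := fun σ => by
    have hblock := blockPerm_hasFirstBlock a b
    constructor
    · intro h i
      have h1 := h (Fin.castAdd r i)
      have h2 := hblock i
      have := i.isLt
      rw [Fin.val_castAdd] at h1
      ext
      rw [Fin.val_castAdd]
      omega
    · intro h i
      by_cases hi : (i : ℕ) < a + b
      · have h1 : (σ i : ℕ) = blockPerm a b ⟨i, hi⟩ := congrArg Fin.val (h ⟨i, hi⟩)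
        have h2 := hblock ⟨i, hi⟩
        simp only at h2
        rwa [← h1] at h2
      · constructor <;> intros <;> omega
  symm
  refine Nat.card_eq_of_bijective (fun τ => ⟨directSum (blockPerm a b) τ.1,
    (isSepAvoiding_directSum _ _).2 ⟨isSepAvoiding_blockPerm a b, τ.2⟩,
    (key _).2 (directSum_castAdd _ _)⟩) ⟨?_, ?_⟩
  · intro τ τ' h
    exact Subtype.ext (directSum_right_injective _ (congrArg Subtype.val h))
  · rintro ⟨σ, hσ, hb⟩
    obtain ⟨τ, rfl⟩ := exists_directSum_eq _ σ ((key σ).1 hb)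
    exact ⟨⟨τ, ((isSepAvoiding_directSum _ _).1 hσ).2⟩, rfl⟩

theorem HasFirstBlock.apply_zero {n a b : ℕ} {σ : Equiv.Perm (Fin (n + 1))} (ha : 0 < a)
    (h : HasFirstBlock a b σ) : (σ 0 : ℕ) = b := by
  simpa using (h 0).1 ha

theorem HasFirstBlock.symm_zero {n a b : ℕ} {σ : Equiv.Perm (Fin (n + 1))} (hb : 0 < b)
    (hab : a + b ≤ n + 1) (h : HasFirstBlock a b σ) : (σ.symm 0 : ℕ) = a := by
  have h1 := (h ⟨a, by omega⟩).2 le_rfl (by simp; omega)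
  have h2 : σ ⟨a, by omega⟩ = 0 := Fin.ext (by simpa using h1)
  rw [← h2, Equiv.symm_apply_apply]

theorem card_sepAvoiding_succ (n : ℕ) :
    Nat.card {σ : Equiv.Perm (Fin (n + 1)) // IsSepAvoiding σ} =
      Nat.card {σ : Equiv.Perm (Fin n) // IsSepAvoiding σ} +
      ∑ x ∈ Finset.HasAntidiagonal.antidiagonal n,
        x.1 * Nat.card {σ : Equiv.Perm (Fin x.2) // IsSepAvoiding σ} := by
  classical
  have card_filter : ∀ (P : Equiv.Perm (Fin (n + 1)) → Prop) [DecidablePred P],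
      Nat.card {σ // P σ} = (Finset.univ.filter P).card := fun P _ => by
    rw [Nat.card_eq_fintype_card, Fintype.card_subtype]
  rw [card_filter, ← Finset.card_filter_add_card_filter_not (fun σ => σ 0 = 0)]
  -- `σ 0 = 0` is the first block `(1, 0)`
  congr 1
  · rw [← card_hasFirstBlock (a := 1) (b := 0) (r := n) (n := n + 1) (by omega), card_filter,
      Finset.filter_filter]
    congr 1
    refine Finset.filter_congr fun σ _ => and_congr_right fun _ => ⟨fun h i => ?_, fun h => ?_⟩
    · constructor
      · intro hi
        have : i = 0 := Fin.ext (by simpa using hi)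
        simp [this, h]
      · intros
        omega
    · exact Fin.ext (h.apply_zero one_pos)
  · -- a pair `x` in the antidiagonal and `c < x.1` stand for the block of size `x.1 + 1` whose
    -- first value is `c + 1`
    rw [Finset.card_eq_sum_card_fiberwise
      (f := fun σ : Equiv.Perm (Fin (n + 1)) => (⟨((σ.symm 0 : ℕ) + (σ 0 : ℕ) - 1,
        n + 1 - ((σ.symm 0 : ℕ) + (σ 0 : ℕ))),
        (σ 0 : ℕ) - 1⟩ : Σ _ : ℕ × ℕ, ℕ))
      (t := (Finset.HasAntidiagonal.antidiagonal n).sigma fun x => Finset.range x.1),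
      Finset.sum_sigma]
    · refine Finset.sum_congr rfl fun x hx => ?_
      rw [Finset.HasAntidiagonal.mem_antidiagonal] at hx
      obtain ⟨p, r⟩ := x
      simp only at hx ⊢
      rw [← smul_eq_mul, ← Finset.card_range p, ← Finset.sum_const, Finset.card_range]
      refine Finset.sum_congr rfl fun c hc => ?_
      rw [Finset.mem_range] at hc
      rw [← card_hasFirstBlock (a := p - c) (b := c + 1) (r := r) (n := n + 1) (by omega),
        card_filter, Finset.filter_filter, Finset.filter_filter]
      congr 1
      refine Finset.filter_congr fun σ _ => ?_
      simp only [Sigma.mk.injEq, Prod.mk.injEq, heq_eq_eq]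
      constructor
      · rintro ⟨h, h0, ⟨h1, h2⟩, h3⟩
        have hpos : 0 < (σ 0 : ℕ) := Fin.pos_iff_ne_zero.2 h0
        have hblock := HasFirstBlock.of_apply_zero h
        rw [show (σ 0 : ℕ) = c + 1 by omega, show (σ.symm 0 : ℕ) = p - c by omega] at hblock
        exact ⟨h, hblock⟩
      · rintro ⟨h, hblock⟩
        have h1 := hblock.apply_zero (by omega)
        have h2 := hblock.symm_zero (by omega) (by omega)
        refine ⟨h, fun h0 => ?_, ⟨by omega, by omega⟩, by omega⟩
        rw [h0] at h1
        simp at h1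
    · intro σ hσ
      simp only [Finset.coe_filter, Finset.mem_filter, Finset.mem_univ, true_and,
        Set.mem_ofPred_eq] at hσ
      obtain ⟨h, h0⟩ := hσ
      have hpos : 0 < (σ 0 : ℕ) := Fin.pos_iff_ne_zero.2 h0
      have hpos' : 0 < (σ.symm 0 : ℕ) := Fin.pos_iff_ne_zero.2 fun e => h0 (by
        rw [Equiv.symm_apply_eq] at e
        exact e.symm)
      have hle := h.symm_zero_add_apply_zero_le
      simp only [Finset.coe_sigma, Set.mem_sigma_iff, Finset.mem_coe,
        Finset.HasAntidiagonal.mem_antidiagonal, Finset.mem_range]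
      omega

theorem card_sepAvoiding_zero : Nat.card {σ : Equiv.Perm (Fin 0) // IsSepAvoiding σ} = 1 := by
  rw [Nat.card_eq_one_iff_unique]
  refine ⟨inferInstance, ⟨1, ?_, ?_, ?_⟩⟩ <;> rintro ⟨f, -⟩ <;> exact (f 0).elim0

theorem card_evenColored_eq_card_sepAvoiding (n : ℕ) :
    Nat.card (EvenColoredComposition n) =
      Nat.card {σ : Equiv.Perm (Fin n) // IsSepAvoiding σ} := by
  induction n using Nat.strong_induction_on with
  | _ n ih =>
    cases n with
    | zero => rw [card_positionalColoredComposition_zero, card_sepAvoiding_zero]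
    | succ n =>
      rw [card_evenColored_succ, card_sepAvoiding_succ, ih n n.lt_succ_self]
      congr 1
      refine Finset.sum_congr rfl fun x hx => ?_
      rw [ih x.2 (by have := Finset.HasAntidiagonal.mem_antidiagonal.1 hx; omega)]

theorem mainTheorem3 (k : ℕ) (hk : 0 < k) :
    Nonempty (EvenColoredComposition k ≃
      {σ : Equiv.Perm (Fin k) // AvoidsPattern σ ![3, 2, 1] ∧ IsSeparablePerm σ}) := by
  exact Finite.card_eq.1 (card_evenColored_eq_card_sepAvoiding k)
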